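/- An element $a$ of a complex unital Banach algebra is called hermitian if $\|\exp(ita)\|=1$ for all $t\in\mathbb{R}$. A measure algebra $(\mathfrak{A},\mu)$ is a $\sigma$-complete Boolean algebra $\mathfrak{A}$ with a $\sigma$-additive map $\mu\colon\mathfrak{A}\to[0,\infty]$ such that $\mu(E)=0$ only for $E=0$; it is localizable if $\mathfrak{A}$ is a complete lattice and every $E\in\mathfrak{A}$ with $\mu(E)=\infty$ admits a nonzero $E'\leq E$ with $\mu(E')<\infty$. The spaces $L^p(\mathfrak{A},\mu)$ are those of a measure space whose measure algebra is $(\mathfrak{A},\mu)$, namely of the Stone space of $\mathfrak{A}$ with the $\sigma$-algebra generated by its clopen sets, where a set that differs from the clopen set of $E\in\mathfrak{A}$ by a meagre set has measure $\mu(E)$. All $L^p$-spaces are complex unless marked by the subscript $\mathbb{R}$. Let $p\in[1,\infty)\setminus\{2\}$. (1) Let $(\mathfrak{A},\mu)$ be a nonzero localizable measure algebra and let $a$ be a bounded operator on $L^p(\mathfrak{A},\mu)$. Then $a$ is hermitian (in the algebra of bounded operators) if and only if there exists $h\in L^\infty_{\mathbb{R}}(\mathfrak{A},\mu)$ such that $a$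 is the operator $f\mapsto hf$ of multiplication by $h$. The same holds for bounded operators on $L^p(X,\Sigma,\mu)$, with $h\in L^\infty_{\mathbb{R}}(X,\Sigma,\mu)$, whenever $(X,\Sigma,\mu)$ is a localizable measure space with $\mu\neq 0$, that is, $\mu$ is semi-finite and every family of measurable sets has an essential supremum. (2) Let $(X,\Sigma,\mu)$ be any measure space. If $a$ and $b$ are hermitian bounded operators on $L^p(X,\Sigma,\mu)$, then so is $ab$. -/

import Mathlib

open MeasureTheory Filter Topology
open scoped ENNReal

universe u v

noncomputable section

/-! ### Hermitian elements -/

/-- An element `a` of a complex unital Banach algebra is hermitian if `‖exp (i t a)‖ = 1` for all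
real `t`. -/
def IsHermitianElement {A : Type*} [NormedRing A] [NormedAlgebra ℂ A] (a : A) : Prop :=
  ∀ t : ℝ, ‖NormedSpace.exp ((Complex.I * (t : ℂ)) • a)‖ = 1

/-! ### Multiplication operators -/

/-- `a` is the operator on the complex space `L^p(μ)` of multiplication by `h ∈ L^∞_ℝ(μ)`. -/
def IsMultiplicationBy {X : Type*} [MeasurableSpace X] {μ : Measure X} {p : ℝ≥0∞} [Fact (1 ≤ p)]
    (a : Lp ℂ p μ →L[ℂ] Lp ℂ p μ) (h : Lp ℝ ∞ μ) : Prop :=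
  ∀ f : Lp ℂ p μ, (a f : X → ℂ) =ᵐ[μ] fun x => ((h x : ℝ) : ℂ) * f x

/-! ### Localizable measure spaces -/

/-- A measure is localizable if it is semi-finite and every family of measurable sets has an
essential supremum. -/
structure IsLocalizableMeasure {X : Type*} [MeasurableSpace X] (μ : Measure X) : Prop where
  semifinite : ∀ E : Set X, MeasurableSet E → μ E = ∞ →
    ∃ F ⊆ E, MeasurableSet F ∧ 0 < μ F ∧ μ F < ∞
  exists_essSup : ∀ S : Set (Set X), (∀ E ∈ S, MeasurableSet E) →
    ∃ H, MeasurableSet H ∧ (∀ E ∈ S, μ (E \ H) = 0) ∧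
      ∀ G, MeasurableSet G → (∀ E ∈ S, μ (E \ G) = 0) → μ (H \ G) = 0

/-! ### Measure algebras -/

/-- A measure algebra structure on the Boolean algebra `𝔄`: the algebra is `σ`-complete, and
`measure` is `σ`-additive and vanishes only at `⊥`. -/
structure MeasureAlgebra (𝔄 : Type*) [BooleanAlgebra 𝔄] where
  measure : 𝔄 → ℝ≥0∞
  exists_isLUB : ∀ f : ℕ → 𝔄, ∃ s, IsLUB (Set.range f) s
  measure_isLUB : ∀ f : ℕ → 𝔄, (∀ i j, i ≠ j → Disjoint (f i) (f j)) →
    ∀ s, IsLUB (Set.range f) s → measure s = ∑' n, measure (f n)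
  measure_eq_zero_iff : ∀ a, measure a = 0 ↔ a = ⊥

/-- A measure algebra is localizable if it is semi-finite and its Boolean algebra is a complete
lattice. -/
structure MeasureAlgebra.IsLocalizable {𝔄 : Type*} [BooleanAlgebra 𝔄] (M : MeasureAlgebra 𝔄) :
    Prop where
  semifinite : ∀ a, M.measure a = ∞ → ∃ b ≤ a, b ≠ ⊥ ∧ M.measure b < ∞
  complete : ∀ S : Set 𝔄, ∃ s, IsLUB S s

/-! ### The Stone space of a Boolean algebra -/

/-- The Stone space of `𝔄`: the set of Boolean homomorphisms from `𝔄` to the two-element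
algebra. -/
def StoneSpace (𝔄 : Type*) [BooleanAlgebra 𝔄] : Type _ :=
  {φ : 𝔄 → Bool // φ ⊤ = true ∧ (∀ a b, φ (a ⊓ b) = (φ a && φ b)) ∧ ∀ a, φ aᶜ = !φ a}

namespace StoneSpace

variable {𝔄 : Type*} [BooleanAlgebra 𝔄]

/-- The topology of pointwise convergence. -/
instance : TopologicalSpace (StoneSpace 𝔄) := instTopologicalSpaceSubtype

/-- The clopen subset of the Stone space that corresponds to `a ∈ 𝔄`. -/
def clopen (a : 𝔄) : Set (StoneSpace 𝔄) := {φ | φ.1 a = true}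

/-- The `σ`-algebra on the Stone space generated by the clopen sets. -/
instance : MeasurableSpace (StoneSpace 𝔄) := MeasurableSpace.generateFrom (Set.range clopen)

theorem clopen_top : clopen (⊤ : 𝔄) = Set.univ := by
  ext φ; simp [clopen, φ.2.1]

theorem clopen_inf (a b : 𝔄) : clopen (a ⊓ b) = clopen a ∩ clopen b := by
  ext φ; simp [clopen, φ.2.2.1]

theorem clopen_compl (a : 𝔄) : clopen aᶜ = (clopen a)ᶜ := by
  ext φ; simp [clopen, φ.2.2.2]

theorem clopen_bot : clopen (⊥ : 𝔄) = ∅ := by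
  rw [← compl_top, clopen_compl, clopen_top, Set.compl_univ]

theorem clopen_mono {a b : 𝔄} (h : a ≤ b) : clopen a ⊆ clopen b := by
  rw [← inf_eq_left.2 h, clopen_inf]; exact Set.inter_subset_right

theorem isClopen_clopen (a : 𝔄) : IsClopen (clopen a) :=
  (isClopen_discrete ({true} : Set Bool)).preimage
    ((continuous_apply a).comp continuous_subtype_val)

theorem measurableSet_clopen (a : 𝔄) : MeasurableSet (clopen a) :=
  MeasurableSpace.measurableSet_generateFrom ⟨a, rfl⟩

instance : CompactSpace (StoneSpace 𝔄) := by
  refine isCompact_iff_compactSpace.1 (IsClosed.isCompact (X := 𝔄 → Bool) ?_)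
  refine IsClosed.inter ?_ (IsClosed.inter ?_ ?_)
  · exact isClosed_eq (continuous_apply _) continuous_const
  · have : {φ : 𝔄 → Bool | ∀ a b, φ (a ⊓ b) = (φ a && φ b)} =
        ⋂ a, ⋂ b, {φ : 𝔄 → Bool | φ (a ⊓ b) = (φ a && φ b)} := by ext; simp
    change IsClosed {φ : 𝔄 → Bool | ∀ a b, φ (a ⊓ b) = (φ a && φ b)}
    rw [this]
    refine isClosed_iInter fun a => isClosed_iInter fun b => isClosed_eq
      (continuous_apply _) ?_
    have hand : Continuous fun x : Bool × Bool => x.1 && x.2 := continuous_of_discreteTopology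
    have hpair : Continuous fun φ : 𝔄 → Bool => (φ a, φ b) :=
      (continuous_apply a).prodMk (continuous_apply b)
    exact hand.comp hpair
  · have : {φ : 𝔄 → Bool | ∀ a, φ aᶜ = !φ a} = ⋂ a, {φ : 𝔄 → Bool | φ aᶜ = !φ a} := by
      ext; simp
    change IsClosed {φ : 𝔄 → Bool | ∀ a, φ aᶜ = !φ a}
    rw [this]
    refine isClosed_iInter fun a => isClosed_eq (continuous_apply _) ?_
    exact (continuous_of_discreteTopology (f := Bool.not)).comp (continuous_apply a)

instance : T2Space (StoneSpace 𝔄) :=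
  inferInstanceAs (T2Space (Subtype _))

theorem clopen_nonempty {a : 𝔄} (ha : a ≠ ⊥) : (clopen a).Nonempty := by
  classical
  obtain ⟨J, hJ, -, hd⟩ := DistribLattice.prime_ideal_of_disjoint_filter_ideal
    (F := Order.PFilter.principal a) (I := Order.Ideal.principal (⊥ : 𝔄)) (by
      rw [Set.disjoint_left]
      intro x hx hx'
      have h1 : a ≤ x := hx
      have h2 : x ≤ ⊥ := hx'
      exact ha (le_bot_iff.1 (h1.trans h2)))
  have haJ : a ∉ J := fun h => Set.disjoint_left.1 hd (show a ∈ Order.PFilter.principal a from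
    le_refl a) h
  have htop : (⊤ : 𝔄) ∉ J := fun h => haJ (J.lower le_top h)
  refine ⟨⟨fun x => decide (x ∉ J), by simpa using htop, fun x y => ?_, fun x => ?_⟩,
    decide_eq_true haJ⟩
  · rw [← Bool.decide_and, decide_eq_decide]
    refine ⟨fun h => ⟨fun hx => h (J.lower inf_le_left hx), fun hy => h (J.lower inf_le_right hy)⟩,
      fun h hxy => ?_⟩
    exact (hJ.mem_or_mem hxy).elim h.1 h.2
  · rw [← decide_not, decide_eq_decide, not_not]
    refine ⟨fun h => (hJ.mem_or_compl_mem).resolve_right h, fun h h' => htop ?_⟩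
    rw [← sup_compl_eq_top (x := x)]
    exact Order.Ideal.sup_mem h h'

theorem eq_of_residualEq {a b : 𝔄}
    (h : clopen a =ᶠ[residual (StoneSpace 𝔄)] clopen b) : a = b := by
  have key : ∀ c d : 𝔄, clopen c =ᶠ[residual (StoneSpace 𝔄)] clopen d → c ≤ d := by
    intro c d hcd
    by_contra hle
    have hne : c ⊓ dᶜ ≠ ⊥ := fun h0 => hle (by
      rwa [← disjoint_iff, disjoint_compl_right_iff] at h0)
    refine not_isMeagre_of_isOpen (isClopen_clopen (c ⊓ dᶜ)).isOpen (clopen_nonempty hne) ?_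
    rw [IsMeagre]
    filter_upwards [hcd.mem_iff] with φ hφ
    rw [clopen_inf, clopen_compl]
    exact fun h' => h'.2 (hφ.1 h'.1)
  exact le_antisymm (key a b h) (key b a h.symm)

/-- The clopen set of a countable supremum agrees with the union up to a meagre set. -/
theorem iUnion_clopen_residualEq {f : ℕ → 𝔄} {s : 𝔄} (hs : IsLUB (Set.range f) s) :
    (⋃ n, clopen (f n)) =ᶠ[residual (StoneSpace 𝔄)] clopen s := by
  have hopen : IsOpen (⋃ n, clopen (f n)) := isOpen_iUnion fun n => (isClopen_clopen _).isOpen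
  have hsub : (⋃ n, clopen (f n)) ⊆ clopen s :=
    Set.iUnion_subset fun n => clopen_mono (hs.1 ⟨n, rfl⟩)
  have hdense : Dense ((⋃ n, clopen (f n)) ∪ (clopen s)ᶜ) := by
    rw [dense_iff_inter_open]
    rintro U hU ⟨φ, hφ⟩
    by_contra hne
    rw [Set.not_nonempty_iff_eq_empty] at hne
    have hUs : U ⊆ clopen s := fun ψ hψ => by
      by_contra h
      exact (Set.eq_empty_iff_forall_notMem.1 hne ψ) ⟨hψ, Or.inr h⟩
    have hUf : ∀ n, Disjoint U (clopen (f n)) := fun n => Set.disjoint_left.2 fun ψ h1 h2 =>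
      (Set.eq_empty_iff_forall_notMem.1 hne ψ) ⟨h1, Or.inl (Set.mem_iUnion.2 ⟨n, h2⟩)⟩
    -- a basic clopen neighbourhood of `φ` inside `U`
    obtain ⟨c, hφc, hcU⟩ : ∃ c : 𝔄, φ ∈ clopen c ∧ clopen c ⊆ U := by
      obtain ⟨V, hV, rfl⟩ := isOpen_induced_iff.1 hU
      obtain ⟨I, u, hu, huV⟩ := isOpen_pi_iff.1 hV φ.1 hφ
      let g : 𝔄 → 𝔄 := fun a => if φ.1 a = true then a else aᶜ
      have hg : ∀ J : Finset 𝔄, clopen (J.inf g) = {ψ | ∀ a ∈ J, ψ.1 a = φ.1 a} := by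
        classical
        intro J
        induction J using Finset.induction_on with
        | empty => ext; simp [clopen_top]
        | insert a J haJ ih =>
          rw [Finset.inf_insert, clopen_inf, ih]
          ext ψ
          have : ψ ∈ clopen (g a) ↔ ψ.1 a = φ.1 a := by
            by_cases h : φ.1 a = true
            · simp [g, h, clopen]
            · simp [g, h, clopen_compl]; simp [clopen]
          simp [this]
      refine ⟨I.inf g, by rw [hg]; exact fun a _ => rfl, ?_⟩
      rw [hg]
      intro ψ hψ
      refine huV fun a ha => ?_
      rw [hψ a ha]
      exact (hu a ha).2
    have hle : s ≤ cᶜ := hs.2 (by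
      rintro _ ⟨n, rfl⟩
      rw [le_compl_iff_disjoint_right, disjoint_iff]
      by_contra h0
      obtain ⟨ψ, hψ⟩ := clopen_nonempty h0
      rw [clopen_inf] at hψ
      exact Set.disjoint_left.1 (hUf n) (hcU hψ.2) hψ.1)
    have := clopen_mono hle (hUs hφ)
    rw [clopen_compl] at this
    exact this hφc
  have := residual_of_dense_open (hopen.union (isClopen_clopen s).compl.isOpen) hdense
  filter_upwards [this] with φ hφ
  refine propext ⟨fun h => hsub h, fun h => hφ.resolve_right fun h' => h' h⟩

end StoneSpace

/-! ### The measure space and the `L^p`-space of a measure algebra -/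

namespace MeasureAlgebra

open StoneSpace

variable {𝔄 : Type*} [BooleanAlgebra 𝔄]

/-- Every set in the `σ`-algebra generated by the clopen sets agrees with a clopen set up to a
meagre set. -/
theorem exists_residualEq (M : MeasureAlgebra 𝔄) {E : Set (StoneSpace 𝔄)} (hE : MeasurableSet E) :
    ∃ a : 𝔄, E =ᶠ[residual (StoneSpace 𝔄)] clopen a := by
  induction E, hE using MeasurableSpace.generateFrom_induction with
  | hC t ht _ => obtain ⟨a, rfl⟩ := ht; exact ⟨a, EventuallyEq.rfl⟩
  | empty => exact ⟨⊥, by rw [clopen_bot]; exact EventuallyEq.rfl⟩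
  | compl t _ ih =>
    obtain ⟨a, ha⟩ := ih
    exact ⟨aᶜ, by rw [clopen_compl]; exact ha.compl⟩
  | iUnion f _ ih =>
    choose a ha using ih
    obtain ⟨s, hs⟩ := M.exists_isLUB a
    exact ⟨s, (Filter.EventuallyEq.countable_iUnion ha).trans (iUnion_clopen_residualEq hs)⟩

/-- The element of `𝔄` whose clopen set agrees with `E` up to a meagre set. -/
def elementOf (M : MeasureAlgebra 𝔄) (E : Set (StoneSpace 𝔄)) (hE : MeasurableSet E) : 𝔄 :=
  (M.exists_residualEq hE).choose

theorem elementOf_spec (M : MeasureAlgebra 𝔄) (E : Set (StoneSpace 𝔄)) (hE : MeasurableSet E) :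
    E =ᶠ[residual (StoneSpace 𝔄)] clopen (M.elementOf E hE) :=
  (M.exists_residualEq hE).choose_spec

theorem elementOf_eq (M : MeasureAlgebra 𝔄) {E : Set (StoneSpace 𝔄)} (hE : MeasurableSet E) {a : 𝔄}
    (h : E =ᶠ[residual (StoneSpace 𝔄)] clopen a) : M.elementOf E hE = a :=
  eq_of_residualEq ((M.elementOf_spec E hE).symm.trans h)

/-- The measure on the Stone space of `𝔄` that realizes the measure algebra: the measure of a set
that agrees with the clopen set of `a` up to a meagre set is the measure of `a`. -/
def stoneMeasure (M : MeasureAlgebra 𝔄) : Measure (StoneSpace 𝔄) :=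
  Measure.ofMeasurable (fun E hE => M.measure (M.elementOf E hE))
    (by
      rw [M.elementOf_eq MeasurableSet.empty (a := ⊥) (by rw [clopen_bot]; exact EventuallyEq.rfl),
        M.measure_eq_zero_iff])
    (by
      intro f hf hd
      obtain ⟨s, hs⟩ := M.exists_isLUB fun n => M.elementOf (f n) (hf n)
      have h1 : M.elementOf (⋃ i, f i) (MeasurableSet.iUnion hf) = s :=
        M.elementOf_eq _ ((Filter.EventuallyEq.countable_iUnion fun n => M.elementOf_spec (f n) (hf n)).trans
          (iUnion_clopen_residualEq hs))
      rw [h1]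
      refine M.measure_isLUB _ (fun i j hij => ?_) s hs
      rw [disjoint_iff]
      refine eq_of_residualEq ?_
      rw [clopen_inf, clopen_bot, ← Set.disjoint_iff_inter_eq_empty.1 (hd hij)]
      exact ((M.elementOf_spec (f i) (hf i)).inter (M.elementOf_spec (f j) (hf j))).symm)

theorem stoneMeasure_apply (M : MeasureAlgebra 𝔄) {E : Set (StoneSpace 𝔄)} (hE : MeasurableSet E) :
    M.stoneMeasure E = M.measure (M.elementOf E hE) :=
  Measure.ofMeasurable_apply E hE

theorem stoneMeasure_clopen (M : MeasureAlgebra 𝔄) (a : 𝔄) :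
    M.stoneMeasure (clopen a) = M.measure a := by
  rw [M.stoneMeasure_apply (measurableSet_clopen a), M.elementOf_eq _ EventuallyEq.rfl]

/-- The measure algebra of the Stone space is `𝔄`: modulo null sets, every measurable set is the
clopen set of exactly one element of `𝔄`. -/
theorem existsUnique_ae_eq_clopen (M : MeasureAlgebra 𝔄) {E : Set (StoneSpace 𝔄)}
    (hE : MeasurableSet E) : ∃! a : 𝔄, E =ᵐ[M.stoneMeasure] clopen a := by
  have null : ∀ F : Set (StoneSpace 𝔄), MeasurableSet F →
      (M.stoneMeasure F = 0 ↔ F =ᶠ[residual (StoneSpace 𝔄)] (∅ : Set (StoneSpace 𝔄))) := by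
    intro F hF
    rw [M.stoneMeasure_apply hF, M.measure_eq_zero_iff, ← clopen_bot]
    exact ⟨fun h => h ▸ M.elementOf_spec F hF, fun h => M.elementOf_eq hF h⟩
  have iff : ∀ a : 𝔄, E =ᵐ[M.stoneMeasure] clopen a ↔
      E =ᶠ[residual (StoneSpace 𝔄)] clopen a := by
    intro a
    rw [ae_eq_set, null _ (hE.diff (measurableSet_clopen a)),
      null _ ((measurableSet_clopen a).diff hE)]
    constructor
    · rintro ⟨h1, h2⟩
      filter_upwards [h1.mem_iff, h2.mem_iff] with φ h1 h2
      refine propext ⟨fun h => ?_, fun h => ?_⟩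
      · by_contra h'; exact h1.1 ⟨h, h'⟩
      · by_contra h'; exact h2.1 ⟨h, h'⟩
    · intro h
      constructor <;> filter_upwards [h.mem_iff] with φ h <;>
        refine propext ⟨fun h' => ?_, fun h' => h'.elim⟩
      · exact h'.2 (h.1 h'.1)
      · exact h'.2 (h.2 h'.1)
  refine ⟨M.elementOf E hE, (iff _).2 (M.elementOf_spec E hE), fun b hb => ?_⟩
  exact (M.elementOf_eq hE ((iff b).1 hb)).symm

/-- The complex space `L^p(𝔄, μ)` of a measure algebra. -/
abbrev Lp (M : MeasureAlgebra 𝔄) (p : ℝ≥0∞) := MeasureTheory.Lp ℂ p M.stoneMeasure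

/-- The real space `L^∞_ℝ(𝔄, μ)` of a measure algebra. -/
abbrev LinftyReal (M : MeasureAlgebra 𝔄) := MeasureTheory.Lp ℝ ∞ M.stoneMeasure

end MeasureAlgebra

end

/-!
Put `δ z w = 2‖z‖ᵖ + 2‖w‖ᵖ - ‖z + w‖ᵖ - ‖z - w‖ᵖ`. For `p ≠ 2` the number `(2 - p) δ z w` is
nonnegative and vanishes only if `z = 0` or `w = 0`, whereas `∫ δ (f x) (g x)` is an expression in
the `L^p`-norms of `f`, `g`, `f + g` and `f - g`. Hence linear isometries map functions with
disjoint supports to functions with disjoint supports (Lamperti).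

If `a` is hermitian, the isometries `exp (i t a)` have this property, and differentiating at `t = 0`
shows that `a` does not enlarge supports. So `a` and `exp (i t a)` commute with the multiplication
by indicator functions, and therefore `|exp (i t a) f| = |f|` almost everywhere. Differentiating
again, `i a f` is orthogonal to `f` at almost every point: on each set of finite measure `a` is the
multiplication by a real function. Conversely, such a local real multiplication satisfies
`‖1 + i t a‖ ≤ 1 + ‖a‖² t² / 2`, whence `‖exp (i t a)‖ ≤ lim (1 + O(t² / n²))ⁿ = 1`. Local real
multiplications are closed under products, and localizability is what glues the local multipliers
to one element of `L^∞`.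
-/

section Clarkson

theorem map_add_lt_of_strictConcaveOn {φ : ℝ → ℝ} (hφ : StrictConcaveOn ℝ (Set.Ici 0) φ)
    (h0 : φ 0 = 0) {x y : ℝ} (hx : 0 < x) (hy : 0 < y) : φ (x + y) < φ x + φ y := by
  have hs : 0 < x + y := add_pos hx hy
  have scaled_lt : ∀ u, 0 < u → u < x + y → u / (x + y) * φ (x + y) < φ u := fun u hu hus => by
    have h := hφ.2 (Set.mem_Ici.2 hs.le) Set.self_mem_Ici hs.ne' (div_pos hu hs)
      (sub_pos.2 ((div_lt_one hs).2 hus)) (add_sub_cancel _ _)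
    simpa only [smul_eq_mul, h0, mul_zero, add_zero, div_mul_cancel₀ u hs.ne'] using h
  calc φ (x + y) = x / (x + y) * φ (x + y) + y / (x + y) * φ (x + y) := by field_simp
    _ < φ x + φ y := add_lt_add (scaled_lt x hx (by linarith)) (scaled_lt y hy (by linarith))

variable {E : Type*} [NormedAddCommGroup E]

/-- The defect in Clarkson's inequality with exponent `p`. Its integral is an expression in the
norms of `L^p`, while for `p ≠ 2` its vanishing detects that `z` or `w` vanishes. -/
noncomputable def clarksonDefect (p : ℝ) (z w : E) : ℝ :=
  2 * ‖z‖ ^ p + 2 * ‖w‖ ^ p - ‖z + w‖ ^ p - ‖z - w‖ ^ p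

theorem clarksonDefect_eq_zero {p : ℝ} (hp : p ≠ 0) {z w : E} (h : z = 0 ∨ w = 0) :
    clarksonDefect p z w = 0 := by
  rcases h with rfl | rfl <;>
    simp only [clarksonDefect, norm_zero, norm_neg, Real.zero_rpow hp, zero_add, add_zero,
      zero_sub, sub_zero] <;> ring

variable [InnerProductSpace ℝ E]

theorem map_norm_sq_add_lt_of_strictConcaveOn {φ : ℝ → ℝ}
    (hφ : StrictConcaveOn ℝ (Set.Ici 0) φ) (h0 : φ 0 = 0) {z w : E} (hz : z ≠ 0) (hw : w ≠ 0) :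
    φ (‖z + w‖ ^ 2) + φ (‖z - w‖ ^ 2) < 2 * φ (‖z‖ ^ 2) + 2 * φ (‖w‖ ^ 2) := by
  have subadditive := map_add_lt_of_strictConcaveOn hφ h0 (pow_pos (norm_pos_iff.2 hz) 2)
    (pow_pos (norm_pos_iff.2 hw) 2)
  have midpoint_eq : (1 / 2 : ℝ) * ‖z + w‖ ^ 2 + (1 / 2 : ℝ) * ‖z - w‖ ^ 2 =
      ‖z‖ ^ 2 + ‖w‖ ^ 2 := by linarith [parallelogram_law_with_norm ℝ z w]
  have midpoint_le := hφ.concaveOn.2 (Set.mem_Ici.2 (sq_nonneg ‖z + w‖))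
    (Set.mem_Ici.2 (sq_nonneg ‖z - w‖)) one_half_pos.le one_half_pos.le (add_halves 1)
  simp only [smul_eq_mul, midpoint_eq] at midpoint_le
  linarith

theorem mul_clarksonDefect_pos {p : ℝ} (hp : 0 < p) (hp2 : p ≠ 2) {z w : E} (hz : z ≠ 0)
    (hw : w ≠ 0) : 0 < (2 - p) * clarksonDefect p z w := by
  have norm_rpow : ∀ x : E, ‖x‖ ^ p = (‖x‖ ^ 2) ^ (p / 2) := fun x => by
    rw [← Real.rpow_natCast_mul (norm_nonneg x), Nat.cast_ofNat, mul_div_cancel₀ p two_ne_zero]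
  have zero_rpow : (0 : ℝ) ^ (p / 2) = 0 := Real.zero_rpow (half_pos hp).ne'
  simp only [clarksonDefect, norm_rpow]
  rcases hp2.lt_or_gt with hlt | hgt
  · have h := map_norm_sq_add_lt_of_strictConcaveOn
      (Real.strictConcaveOn_rpow (half_pos hp) (by linarith)) zero_rpow hz hw
    exact mul_pos (by linarith) (by linarith)
  · have h := map_norm_sq_add_lt_of_strictConcaveOn
      (strictConvexOn_rpow (by linarith : 1 < p / 2)).neg (by simp [zero_rpow]) hz hw
    simp only [Pi.neg_apply] at h
    exact mul_pos_of_neg_of_neg (by linarith) (by linarith)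

theorem mul_clarksonDefect_nonneg {p : ℝ} (hp : 0 < p) (hp2 : p ≠ 2) (z w : E) :
    0 ≤ (2 - p) * clarksonDefect p z w := by
  by_cases h : z = 0 ∨ w = 0
  · rw [clarksonDefect_eq_zero hp.ne' h, mul_zero]
  · rw [not_or] at h
    exact (mul_clarksonDefect_pos hp hp2 h.1 h.2).le

theorem mul_clarksonDefect_eq_zero_iff {p : ℝ} (hp : 0 < p) (hp2 : p ≠ 2) {z w : E} :
    (2 - p) * clarksonDefect p z w = 0 ↔ z = 0 ∨ w = 0 := by
  refine ⟨fun h => ?_, fun h => by rw [clarksonDefect_eq_zero hp.ne' h, mul_zero]⟩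
  by_contra! hzw
  exact (mul_clarksonDefect_pos hp hp2 hzw.1 hzw.2).ne' h

end Clarkson

section Lamperti

variable {X Y E F : Type*} [MeasurableSpace X] [MeasurableSpace Y] {μ : Measure X} {ν : Measure Y}
  [NormedAddCommGroup E] [NormedAddCommGroup F] {p : ℝ≥0∞}

theorem integrable_norm_rpow_Lp (hp0 : p ≠ 0) (hp : p ≠ ∞) (f : Lp E p μ) :
    Integrable (fun x => ‖f x‖ ^ p.toReal) μ :=
  (Lp.memLp f).integrable_norm_rpow hp0 hp

theorem norm_rpow_eq_integral (hp0 : p ≠ 0) (hp : p ≠ ∞) (f : Lp E p μ) :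
    ‖f‖ ^ p.toReal = ∫ x, ‖f x‖ ^ p.toReal ∂μ := by
  have nonneg : 0 ≤ ∫ x, ‖f x‖ ^ p.toReal ∂μ :=
    integral_nonneg fun x => Real.rpow_nonneg (norm_nonneg _) _
  rw [Lp.norm_def, (Lp.memLp f).eLpNorm_eq_integral_rpow_norm hp0 hp,
    ENNReal.toReal_ofReal (Real.rpow_nonneg nonneg _),
    Real.rpow_inv_rpow nonneg (ENNReal.toReal_pos hp0 hp).ne']

theorem integrable_and_integral_clarksonDefect (hp0 : p ≠ 0) (hp : p ≠ ∞) (f g : Lp E p μ) :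
    Integrable (fun x => clarksonDefect p.toReal (f x) (g x)) μ ∧
      ∫ x, clarksonDefect p.toReal (f x) (g x) ∂μ =
        2 * ‖f‖ ^ p.toReal + 2 * ‖g‖ ^ p.toReal - ‖f + g‖ ^ p.toReal - ‖f - g‖ ^ p.toReal := by
  have ae_eq : (fun x => clarksonDefect p.toReal (f x) (g x)) =ᵐ[μ] fun x =>
      2 * ‖f x‖ ^ p.toReal + 2 * ‖g x‖ ^ p.toReal - ‖(f + g) x‖ ^ p.toReal -
        ‖(f - g) x‖ ^ p.toReal := by
    filter_upwards [Lp.coeFn_add f g, Lp.coeFn_sub f g] with x hadd hsub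
    rw [hadd, hsub, Pi.add_apply, Pi.sub_apply, clarksonDefect]
  have hf := (integrable_norm_rpow_Lp hp0 hp f).const_mul 2
  have hg := (integrable_norm_rpow_Lp hp0 hp g).const_mul 2
  have hadd := integrable_norm_rpow_Lp hp0 hp (f + g)
  have hsub := integrable_norm_rpow_Lp hp0 hp (f - g)
  refine ⟨(((hf.add hg).sub hadd).sub hsub).congr ae_eq.symm, ?_⟩
  rw [integral_congr_ae ae_eq, integral_sub (by exact (hf.add hg).sub hadd) hsub,
    integral_sub (by exact hf.add hg) hadd, integral_add hf hg, integral_const_mul,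
    integral_const_mul]
  simp only [norm_rpow_eq_integral hp0 hp]

variable [InnerProductSpace ℝ E] [InnerProductSpace ℝ F]

theorem ae_eq_zero_or_eq_zero_iff_norm_rpow (hp0 : p ≠ 0) (hp : p ≠ ∞) (hp2 : p ≠ 2)
    (f g : Lp E p μ) : (∀ᵐ x ∂μ, f x = 0 ∨ g x = 0) ↔
      2 * ‖f‖ ^ p.toReal + 2 * ‖g‖ ^ p.toReal - ‖f + g‖ ^ p.toReal - ‖f - g‖ ^ p.toReal = 0 := by
  have hpos : 0 < p.toReal := ENNReal.toReal_pos hp0 hp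
  have hp2' : p.toReal ≠ 2 := fun h => hp2 <| by
    rw [← ENNReal.ofReal_toReal hp, h, ENNReal.ofReal_ofNat]
  obtain ⟨integrable, integral_eq⟩ := integrable_and_integral_clarksonDefect hp0 hp f g
  have integral_zero_iff := integral_eq_zero_iff_of_nonneg
    (fun x => mul_clarksonDefect_nonneg hpos hp2' (f x) (g x)) (integrable.const_mul _)
  rw [integral_const_mul, mul_eq_zero_iff_left (sub_ne_zero.2 hp2'.symm), integral_eq]
    at integral_zero_iff
  rw [integral_zero_iff]
  exact eventually_congr (.of_forall fun x => (mul_clarksonDefect_eq_zero_iff hpos hp2').symm)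

theorem ae_eq_zero_or_eq_zero_map_of_norm_map (hp0 : p ≠ 0) (hp : p ≠ ∞) (hp2 : p ≠ 2)
    {U : Lp E p μ →+ Lp F p ν} (hU : ∀ f, ‖U f‖ = ‖f‖) {f g : Lp E p μ}
    (h : ∀ᵐ x ∂μ, f x = 0 ∨ g x = 0) : ∀ᵐ y ∂ν, U f y = 0 ∨ U g y = 0 := by
  rw [ae_eq_zero_or_eq_zero_iff_norm_rpow hp0 hp hp2] at h ⊢
  rw [← map_add, ← map_sub, hU, hU, hU, hU, h]

end Lamperti

section OneParameterGroup

variable {A : Type*} [NormedRing A] [NormedAlgebra ℂ A]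

/-- The one-parameter group `t ↦ exp (i t a)` generated by `i a`. For a hermitian operator `a` it
consists of isometries. -/
noncomputable def expI (a : A) (t : ℝ) : A := NormedSpace.exp ((Complex.I * (t : ℂ)) • a)

theorem expI_zero (a : A) : expI a 0 = 1 := by
  rw [expI, Complex.ofReal_zero, mul_zero, zero_smul, NormedSpace.exp_zero]

theorem commute_expI {a b : A} (h : Commute a b) (t : ℝ) : Commute (expI a t) b := by
  let _ : NormedAlgebra ℚ A := NormedAlgebra.restrictScalars ℚ ℂ A
  exact (h.smul_left _).exp_left

variable [CompleteSpace A]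

theorem expI_add (a : A) (s t : ℝ) : expI a (s + t) = expI a s * expI a t := by
  let _ : NormedAlgebra ℚ A := NormedAlgebra.restrictScalars ℚ ℂ A
  rw [expI, expI, expI, ← NormedSpace.exp_add_of_commute
    (((Commute.refl a).smul_left _).smul_right _), ← add_smul, ← mul_add, Complex.ofReal_add]

theorem expI_neg_mul (a : A) (t : ℝ) : expI a (-t) * expI a t = 1 := by
  rw [← expI_add, neg_add_cancel, expI_zero]

theorem expI_natCast_mul (a : A) (n : ℕ) (t : ℝ) : expI a (n * t) = expI a t ^ n := by
  induction n with
  | zero => rw [Nat.cast_zero, zero_mul, expI_zero, pow_zero]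
  | succ n ih => rw [Nat.cast_succ, add_one_mul, expI_add, ih, pow_succ]

theorem hasDerivAt_expI_zero (a : A) : HasDerivAt (expI a) (Complex.I • a) 0 := by
  have h := hasDerivAt_exp_smul_const (𝕂 := ℝ) (Complex.I • a) 0
  rw [zero_smul, NormedSpace.exp_zero, one_mul] at h
  refine h.congr_of_eventuallyEq (.of_forall fun t => ?_)
  rw [expI, mul_comm, mul_smul, Complex.coe_smul]

open Asymptotics in
theorem tendsto_natCast_mul_comp_div_of_isLittleO {ρ : ℝ → ℝ} (hρ : ρ =o[𝓝 0] (id : ℝ → ℝ))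
    (t : ℝ) : Tendsto (fun n : ℕ => (n : ℝ) * ρ (t / n)) atTop (𝓝 0) := by
  refine (isLittleO_one_iff ℝ).1 (((isBigO_refl (fun n : ℕ => (n : ℝ)) atTop).mul_isLittleO
    (hρ.comp_tendsto (tendsto_const_div_atTop_nhds_zero_nat t))).trans_isBigO
    (isBigO_of_le' (c := |t|) _ fun n => ?_))
  rcases eq_or_ne (n : ℝ) 0 with hn | hn
  · simp [hn]
  · simp [mul_div_cancel₀ t hn]

open Asymptotics in
theorem isHermitianElement_of_norm_one_add_le [NormOneClass A] {a : A} {r : ℝ → ℝ}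
    (hr : r =o[𝓝 0] (id : ℝ → ℝ)) (h : ∀ t : ℝ, ‖1 + (Complex.I * (t : ℂ)) • a‖ ≤ 1 + r t) :
    IsHermitianElement a := by
  let ρ : ℝ → ℝ := fun s => r s + ‖expI a s - 1 - (Complex.I * (s : ℂ)) • a‖
  have norm_le : ∀ s, ‖expI a s‖ ≤ 1 + ρ s := fun s => by
    have := norm_add_le (1 + (Complex.I * (s : ℂ)) • a)
      (expI a s - 1 - (Complex.I * (s : ℂ)) • a)
    rw [sub_sub, add_sub_cancel] at this
    simp only [ρ, sub_sub]
    linarith [h s]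
  have hρ : ρ =o[𝓝 0] (id : ℝ → ℝ) := by
    refine hr.add (IsLittleO.norm_left ?_)
    refine (hasDerivAt_iff_isLittleO_nhds_zero.1 (hasDerivAt_expI_zero a)).congr_left fun s => ?_
    rw [zero_add, expI_zero, mul_comm, mul_smul, Complex.coe_smul]
  have norm_le_one : ∀ t, ‖expI a t‖ ≤ 1 := fun t => by
    have tendsto_exp := (Real.continuous_exp.tendsto 0).comp
      (tendsto_natCast_mul_comp_div_of_isLittleO hρ t)
    rw [Real.exp_zero] at tendsto_exp
    refine ge_of_tendsto tendsto_exp ?_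
    filter_upwards [eventually_ne_atTop 0] with n hn
    calc ‖expI a t‖ = ‖expI a (t / n) ^ n‖ := by
          rw [← expI_natCast_mul, mul_div_cancel₀ t (Nat.cast_ne_zero.2 hn)]
      _ ≤ (1 + ρ (t / n)) ^ n := (norm_pow_le _ n).trans
          (pow_le_pow_left₀ (norm_nonneg _) (norm_le _) n)
      _ ≤ Real.exp (ρ (t / n)) ^ n := pow_le_pow_left₀ ((norm_nonneg _).trans (norm_le _))
          (by linarith [Real.add_one_le_exp (ρ (t / n))]) n
      _ = Real.exp (n * ρ (t / n)) := (Real.exp_nat_mul _ n).symm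
  intro t
  refine le_antisymm (norm_le_one t) ?_
  calc (1 : ℝ) = ‖expI a (-t) * expI a t‖ := by rw [expI_neg_mul, norm_one]
    _ ≤ ‖expI a (-t)‖ * ‖expI a t‖ := norm_mul_le _ _
    _ ≤ ‖expI a t‖ := mul_le_of_le_one_left (norm_nonneg _) (norm_le_one (-t))

theorem IsHermitianElement.nontrivial {E : Type*} [NormedAddCommGroup E] [NormedSpace ℂ E]
    {a : E →L[ℂ] E} (ha : IsHermitianElement a) : Nontrivial E := by
  by_contra! h
  exact zero_ne_one ((ContinuousLinearMap.opNorm_subsingleton _).symm.trans (ha 0))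

theorem IsHermitianElement.norm_expI_apply {E : Type*} [NormedAddCommGroup E] [NormedSpace ℂ E]
    [CompleteSpace E] {a : E →L[ℂ] E} (ha : IsHermitianElement a) (t : ℝ) (f : E) :
    ‖expI a t f‖ = ‖f‖ := by
  have norm_le : ∀ s g, ‖expI a s g‖ ≤ ‖g‖ := fun s g =>
    ((expI a s).le_opNorm g).trans_eq (by rw [expI, ha s, one_mul])
  refine le_antisymm (norm_le t f) ?_
  calc ‖f‖ = ‖expI a (-t) (expI a t f)‖ :=
        congrArg norm (DFunLike.congr_fun (expI_neg_mul a t) f).symm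
    _ ≤ ‖expI a t f‖ := norm_le _ _

theorem hasDerivAt_expI_apply_zero {E : Type*} [NormedAddCommGroup E] [NormedSpace ℂ E]
    [CompleteSpace E] (a : E →L[ℂ] E) (f : E) :
    HasDerivAt (fun t => expI a t f) (Complex.I • a f) 0 :=
  ((ContinuousLinearMap.apply ℂ E f).restrictScalars ℝ).hasFDerivAt.comp_hasDerivAt 0
    (hasDerivAt_expI_zero a)

theorem tendsto_inv_smul_expI_apply_sub {E : Type*} [NormedAddCommGroup E] [NormedSpace ℂ E]
    [CompleteSpace E] (a : E →L[ℂ] E) (f : E) :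
    Tendsto (fun t : ℝ => t⁻¹ • (expI a t f - f)) (𝓝[≠] 0) (𝓝 (Complex.I • a f)) := by
  have h := (hasDerivAt_expI_apply_zero a f).tendsto_slope_zero
  simpa only [zero_add, expI_zero, one_apply_eq_self] using h

theorem tendsto_expI_apply {E : Type*} [NormedAddCommGroup E] [NormedSpace ℂ E]
    [CompleteSpace E] (a : E →L[ℂ] E) (f : E) :
    Tendsto (fun t : ℝ => expI a t f) (𝓝[≠] 0) (𝓝 f) := by
  have h := (hasDerivAt_expI_apply_zero a f).continuousAt.tendsto
  rw [expI_zero, one_apply_eq_self] at h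
  exact h.mono_left nhdsWithin_le_nhds

end OneParameterGroup

section AlmostEverywhereClosed

variable {X E F : Type*} [MeasurableSpace X] {μ : Measure X} {p : ℝ≥0∞} [Fact (1 ≤ p)]
  [NormedAddCommGroup E] [NormedAddCommGroup F]

theorem isClosed_setOf_ae {C : X → E → F → Prop}
    (hC : ∀ x, IsClosed {q : E × F | C x q.1 q.2}) :
    IsClosed {q : Lp E p μ × Lp F p μ | ∀ᵐ x ∂μ, C x (q.1 x) (q.2 x)} := by
  refine IsSeqClosed.isClosed fun u q hu hq => ?_
  obtain ⟨m, hm, tendsto_fst⟩ :=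
    (tendstoInMeasure_of_tendsto_Lp ((continuous_fst.tendsto q).comp hq)).exists_seq_tendsto_ae
  obtain ⟨n, hn, tendsto_snd⟩ := (tendstoInMeasure_of_tendsto_Lp
    ((continuous_snd.tendsto q).comp (hq.comp hm.tendsto_atTop))).exists_seq_tendsto_ae
  filter_upwards [tendsto_fst, tendsto_snd, ae_all_iff.2 hu] with x h₁ h₂ hmem
  exact (hC x).mem_of_tendsto ((h₁.comp hn.tendsto_atTop).prodMk_nhds h₂)
    (.of_forall fun k => hmem (m (n k)))

theorem ae_of_tendsto_Lp {ι : Type*} {l : Filter ι} [NeBot l] {C : X → E → F → Prop}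
    (hC : ∀ x, IsClosed {q : E × F | C x q.1 q.2}) {u : ι → Lp E p μ} {v : ι → Lp F p μ}
    {f : Lp E p μ} {g : Lp F p μ} (hu : Tendsto u l (𝓝 f)) (hv : Tendsto v l (𝓝 g))
    (h : ∀ i, ∀ᵐ x ∂μ, C x (u i x) (v i x)) : ∀ᵐ x ∂μ, C x (f x) (g x) :=
  (isClosed_setOf_ae hC).mem_of_tendsto (hu.prodMk_nhds hv) (.of_forall h)

end AlmostEverywhereClosed

section LocalOperators

variable {X : Type*} [MeasurableSpace X] {μ : Measure X} {p : ℝ≥0∞} [Fact (1 ≤ p)]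

variable (μ p) in
/-- The operator on `L^p` of multiplication by the indicator function of `s`. -/
noncomputable def restrictLp {s : Set X} (hs : MeasurableSet s) : Lp ℂ p μ →L[ℂ] Lp ℂ p μ :=
  (ContinuousLinearMap.mul ℂ ℂ).holderL μ ∞ p p (((memLp_top_const (1 : ℂ)).indicator hs).toLp _)

theorem coeFn_restrictLp {s : Set X} (hs : MeasurableSet s) (f : Lp ℂ p μ) :
    restrictLp μ p hs f =ᵐ[μ] s.indicator (f : X → ℂ) := by
  have hind : MemLp (s.indicator fun _ => (1 : ℂ)) ∞ μ := (memLp_top_const 1).indicator hs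
  have hmul := (ContinuousLinearMap.mul ℂ ℂ).coeFn_holder (r := p) (hind.toLp _) f
  filter_upwards [hmul, hind.coeFn_toLp] with x hx hind_x
  rw [restrictLp, ContinuousLinearMap.holderL_apply_apply, hx, hind_x,
    ContinuousLinearMap.mul_apply']
  by_cases hxs : x ∈ s <;> simp [hxs]

theorem restrictLp_add_compl {s : Set X} (hs : MeasurableSet s) (f : Lp ℂ p μ) :
    restrictLp μ p hs f + restrictLp μ p hs.compl f = f := by
  ext1
  filter_upwards [Lp.coeFn_add (restrictLp μ p hs f) (restrictLp μ p hs.compl f),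
    coeFn_restrictLp hs f, coeFn_restrictLp hs.compl f] with x hadd h₁ h₂
  rw [hadd, Pi.add_apply, h₁, h₂, ← Pi.add_apply, Set.indicator_self_add_compl]

theorem norm_restrictLp_rpow (hp : p ≠ ∞) {s : Set X} (hs : MeasurableSet s) (f : Lp ℂ p μ) :
    ‖restrictLp μ p hs f‖ ^ p.toReal = ∫ x in s, ‖f x‖ ^ p.toReal ∂μ := by
  have hp0 : p ≠ 0 := (zero_lt_one.trans_le Fact.out).ne'
  rw [norm_rpow_eq_integral hp0 hp, ← integral_indicator hs]
  refine integral_congr_ae ?_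
  filter_upwards [coeFn_restrictLp hs f] with x hx
  by_cases hxs : x ∈ s <;> simp [hx, hxs, Real.zero_rpow (ENNReal.toReal_pos hp0 hp).ne']

theorem ae_norm_le_of_norm_restrictLp_le (hp : p ≠ ∞) {f g : Lp ℂ p μ}
    (h : ∀ ⦃s : Set X⦄ (hs : MeasurableSet s), ‖restrictLp μ p hs f‖ ≤ ‖restrictLp μ p hs g‖) :
    ∀ᵐ x ∂μ, ‖f x‖ ≤ ‖g x‖ := by
  have hp0 : p ≠ 0 := (zero_lt_one.trans_le Fact.out).ne'
  have hpos := ENNReal.toReal_pos hp0 hp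
  have rpow_le := ae_le_of_forall_setIntegral_le (integrable_norm_rpow_Lp hp0 hp f)
    (integrable_norm_rpow_Lp hp0 hp g) fun s hs _ => by
      rw [← norm_restrictLp_rpow hp hs, ← norm_restrictLp_rpow hp hs]
      exact Real.rpow_le_rpow (norm_nonneg _) (h hs) hpos.le
  filter_upwards [rpow_le] with x hx
  exact (Real.rpow_le_rpow_iff (norm_nonneg _) (norm_nonneg _) hpos).1 hx

/-- An operator on `L^p` is local if it commutes with the restrictions to measurable sets;
equivalently, it does not enlarge supports. -/
def IsLocal (a : Lp ℂ p μ →L[ℂ] Lp ℂ p μ) : Prop :=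
  ∀ ⦃s : Set X⦄ (hs : MeasurableSet s), Commute a (restrictLp μ p hs)

theorem IsLocal.apply_restrictLp {a : Lp ℂ p μ →L[ℂ] Lp ℂ p μ} (ha : IsLocal a) {s : Set X}
    (hs : MeasurableSet s) (f : Lp ℂ p μ) :
    a (restrictLp μ p hs f) = restrictLp μ p hs (a f) :=
  DFunLike.congr_fun (ha hs) f

theorem isLocal_of_ae_eq_zero_or_eq_zero {a : Lp ℂ p μ →L[ℂ] Lp ℂ p μ}
    (ha : ∀ f g : Lp ℂ p μ, (∀ᵐ x ∂μ, f x = 0 ∨ g x = 0) → ∀ᵐ x ∂μ, a f x = 0 ∨ g x = 0) :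
    IsLocal a := by
  have apply_restrictLp_eq_zero : ∀ ⦃s : Set X⦄ (hs : MeasurableSet s) (f : Lp ℂ p μ),
      ∀ᵐ x ∂μ, x ∉ s → a (restrictLp μ p hs f) x = 0 := fun s hs f => by
    have hg := coeFn_restrictLp hs.compl (a (restrictLp μ p hs f))
    have disjoint := ha (restrictLp μ p hs f) (restrictLp μ p hs.compl (a (restrictLp μ p hs f)))
      (by
        filter_upwards [coeFn_restrictLp hs f, hg] with x h₁ h₂
        by_cases hx : x ∈ s <;> simp [h₁, h₂, hx])
    filter_upwards [disjoint, hg] with x h₁ h₂ hx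
    rwa [h₂, Set.indicator_of_mem (Set.mem_compl hx), or_self] at h₁
  refine fun s hs => ContinuousLinearMap.ext fun f => ?_
  change a (restrictLp μ p hs f) = restrictLp μ p hs (a f)
  have hadd := Lp.coeFn_add (a (restrictLp μ p hs f)) (a (restrictLp μ p hs.compl f))
  rw [← map_add, restrictLp_add_compl hs f] at hadd
  ext1
  filter_upwards [apply_restrictLp_eq_zero hs f, apply_restrictLp_eq_zero hs.compl f,
    coeFn_restrictLp hs (a f), hadd] with x h₁ h₂ h₃ h₄
  rw [h₃]
  by_cases hx : x ∈ s
  · simp [hx, h₄, h₂]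
  · simp [hx, h₁]

theorem IsLocal.ae_norm_apply_le (hp : p ≠ ∞) {a : Lp ℂ p μ →L[ℂ] Lp ℂ p μ} (ha : IsLocal a)
    (f : Lp ℂ p μ) : ∀ᵐ x ∂μ, ‖a f x‖ ≤ ‖a‖ * ‖f x‖ := by
  have norm_le := ae_norm_le_of_norm_restrictLp_le hp (f := a f) (g := (‖a‖ : ℂ) • f)
    fun s hs => by
      rw [← ha.apply_restrictLp hs, map_smul, norm_smul, Complex.norm_real, norm_norm]
      exact a.le_opNorm _
  filter_upwards [norm_le, Lp.coeFn_smul (‖a‖ : ℂ) f] with x hle hsmul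
  rwa [hsmul, Pi.smul_apply, norm_smul, Complex.norm_real, norm_norm] at hle

theorem IsLocal.ae_norm_apply_eq (hp : p ≠ ∞) {a : Lp ℂ p μ →L[ℂ] Lp ℂ p μ} (ha : IsLocal a)
    (h : ∀ f, ‖a f‖ = ‖f‖) (f : Lp ℂ p μ) : ∀ᵐ x ∂μ, ‖a f x‖ = ‖f x‖ := by
  have norm_restrictLp : ∀ ⦃s : Set X⦄ (hs : MeasurableSet s),
      ‖restrictLp μ p hs (a f)‖ = ‖restrictLp μ p hs f‖ := fun s hs => by
    rw [← ha.apply_restrictLp hs, h]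
  filter_upwards [ae_norm_le_of_norm_restrictLp_le hp fun s hs => (norm_restrictLp hs).le,
    ae_norm_le_of_norm_restrictLp_le hp fun s hs => (norm_restrictLp hs).ge] with x hle hge
  exact le_antisymm hle hge

theorem IsLocal.ae_apply_eq_mul (hp : p ≠ ∞) {a : Lp ℂ p μ →L[ℂ] Lp ℂ p μ} (ha : IsLocal a)
    {E : Set X} (hE : MeasurableSet E) (hμE : μ E ≠ ∞) (f : Lp ℂ p μ) :
    ∀ᵐ x ∂μ, x ∈ E → a f x = a (indicatorConstLp p hE hμE (1 : ℂ)) x * f x := by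
  induction f using Lp.induction hp with
  | @indicatorConst c s hs hμs =>
    have restrict_eq : restrictLp μ p hE (indicatorConstLp p hs hμs.ne c) =
        c • restrictLp μ p hs (indicatorConstLp p hE hμE 1) := by
      ext1
      filter_upwards [coeFn_restrictLp hE (indicatorConstLp p hs hμs.ne c),
        Lp.coeFn_smul c (restrictLp μ p hs (indicatorConstLp p hE hμE (1 : ℂ))),
        coeFn_restrictLp hs (indicatorConstLp p hE hμE (1 : ℂ)),
        indicatorConstLp_coeFn (p := p) (hs := hE) (hμs := hμE) (c := (1 : ℂ)),
        indicatorConstLp_coeFn (p := p) (hs := hs) (hμs := hμs.ne) (c := c)] with x h₁ h₂ h₃ h₄ h₅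
      by_cases hxs : x ∈ s <;> by_cases hxE : x ∈ E <;> simp [h₁, h₂, h₃, h₄, h₅, hxs, hxE]
    have apply_eq := congrArg a restrict_eq
    rw [map_smul, ha.apply_restrictLp, ha.apply_restrictLp] at apply_eq
    filter_upwards [coeFn_restrictLp hE (a (indicatorConstLp p hs hμs.ne c)),
      Lp.coeFn_smul c (restrictLp μ p hs (a (indicatorConstLp p hE hμE (1 : ℂ)))),
      coeFn_restrictLp hs (a (indicatorConstLp p hE hμE (1 : ℂ))),
      indicatorConstLp_coeFn (p := p) (hs := hs) (hμs := hμs.ne) (c := c)] with x h₁ h₂ h₃ h₄ hxE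
    rw [Lp.simpleFunc.coe_indicatorConst, h₄]
    rw [Set.indicator_of_mem hxE, apply_eq, h₂, Pi.smul_apply, h₃] at h₁
    rw [← h₁]
    by_cases hxs : x ∈ s <;> simp [hxs, mul_comm]
  | @add f g hf hg _ h₁ h₂ =>
    rw [map_add]
    filter_upwards [h₁, h₂, Lp.coeFn_add (hf.toLp f) (hg.toLp g),
      Lp.coeFn_add (a (hf.toLp f)) (a (hg.toLp g))] with x hx₁ hx₂ hadd haadd hxE
    rw [haadd, hadd, Pi.add_apply, Pi.add_apply, hx₁ hxE, hx₂ hxE, mul_add]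
  | isClosed =>
    refine (isClosed_setOf_ae
      (C := fun x z w => x ∈ E → w = a (indicatorConstLp p hE hμE (1 : ℂ)) x * z)
      fun x => isClosed_imp isOpen_const ?_).preimage (continuous_id.prodMk a.continuous)
    exact isClosed_eq continuous_snd (continuous_const.mul continuous_fst)

end LocalOperators

section HermitianOperators

variable {X : Type*} [MeasurableSpace X] {μ : Measure X} {p : ℝ≥0∞} [Fact (1 ≤ p)]

theorem IsHermitianElement.isLocal (hp : p ≠ ∞) (hp2 : p ≠ 2) {a : Lp ℂ p μ →L[ℂ] Lp ℂ p μ}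
    (ha : IsHermitianElement a) : IsLocal a := by
  have hp0 : p ≠ 0 := (zero_lt_one.trans_le Fact.out).ne'
  refine isLocal_of_ae_eq_zero_or_eq_zero fun f g hfg => ?_
  have mul_difference_quotient : ∀ t : ℝ,
      ∀ᵐ x ∂μ, f x = 0 → (t⁻¹ • (expI a t f - f)) x * expI a t g x = 0 := fun t => by
    filter_upwards [ae_eq_zero_or_eq_zero_map_of_norm_map hp0 hp hp2
        (U := ((expI a t : Lp ℂ p μ →L[ℂ] Lp ℂ p μ) : Lp ℂ p μ →+ Lp ℂ p μ))
        (ha.norm_expI_apply t) hfg,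
      Lp.coeFn_smul t⁻¹ (expI a t f - f), Lp.coeFn_sub (expI a t f) f] with x hx hsmul hsub hf
    rw [hsmul, Pi.smul_apply, hsub, Pi.sub_apply, hf, sub_zero]
    exact mul_eq_zero.2 (hx.imp_left (smul_eq_zero_of_right _))
  have mul_derivative : ∀ᵐ x ∂μ, f x = 0 → (Complex.I • a f) x * g x = 0 :=
    ae_of_tendsto_Lp (C := fun x z w => f x = 0 → z * w = 0)
      (fun x => isClosed_imp isOpen_const
        (isClosed_eq (continuous_fst.mul continuous_snd) continuous_const))
      (tendsto_inv_smul_expI_apply_sub a f) (tendsto_expI_apply a g) mul_difference_quotient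
  filter_upwards [hfg, mul_derivative, Lp.coeFn_smul Complex.I (a f)] with x hx hderiv hsmul
  refine hx.elim (fun hf => ?_) Or.inr
  simpa [hsmul] using hderiv hf

theorem IsHermitianElement.ae_norm_expI_apply_eq (hp : p ≠ ∞) (hp2 : p ≠ 2)
    {a : Lp ℂ p μ →L[ℂ] Lp ℂ p μ} (ha : IsHermitianElement a) (t : ℝ) (f : Lp ℂ p μ) :
    ∀ᵐ x ∂μ, ‖expI a t f x‖ = ‖f x‖ :=
  IsLocal.ae_norm_apply_eq hp (fun _ hs => commute_expI (ha.isLocal hp hp2 hs) t)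
    (ha.norm_expI_apply t) f

-- The derivative at `0` of the constant function `t ↦ ‖expI a t f x‖ ^ 2` vanishes.
theorem IsHermitianElement.ae_inner_I_smul_apply_eq_zero (hp : p ≠ ∞) (hp2 : p ≠ 2)
    {a : Lp ℂ p μ →L[ℂ] Lp ℂ p μ} (ha : IsHermitianElement a) (f : Lp ℂ p μ) :
    ∀ᵐ x ∂μ, inner ℝ (f x) (Complex.I • a f x) = 0 := by
  have inner_difference_quotient : ∀ t : ℝ,
      ∀ᵐ x ∂μ, inner ℝ ((expI a t f + f) x) ((t⁻¹ • (expI a t f - f)) x) = 0 := fun t => by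
    filter_upwards [ha.ae_norm_expI_apply_eq hp hp2 t f, Lp.coeFn_add (expI a t f) f,
      Lp.coeFn_smul t⁻¹ (expI a t f - f), Lp.coeFn_sub (expI a t f) f] with x hx hadd hsmul hsub
    rw [hadd, hsmul, Pi.smul_apply, hsub, Pi.add_apply, Pi.sub_apply, real_inner_smul_right,
      (real_inner_add_sub_eq_zero_iff _ _).2 hx, mul_zero]
  have inner_derivative : ∀ᵐ x ∂μ, inner ℝ ((f + f) x) ((Complex.I • a f) x) = 0 :=
    ae_of_tendsto_Lp (C := fun _ z w => inner ℝ z w = 0)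
      (fun _ => isClosed_eq (continuous_fst.inner continuous_snd) continuous_const)
      ((tendsto_expI_apply a f).add_const f) (tendsto_inv_smul_expI_apply_sub a f)
      inner_difference_quotient
  filter_upwards [inner_derivative, Lp.coeFn_add f f, Lp.coeFn_smul Complex.I (a f)]
    with x hx hadd hsmul
  rwa [hadd, hsmul, Pi.add_apply, Pi.smul_apply, inner_add_left, add_self_eq_zero] at hx

/-- An operator on `L^p` is locally a real multiplication if on every set of finite measure it
agrees with the multiplication by some measurable real function. The functions that belong to
different sets need not come from one function on the whole space, unless the measure is
localizable. -/
def IsLocallyRealMultiplication (a : Lp ℂ p μ →L[ℂ] Lp ℂ p μ) : Prop :=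
  ∀ ⦃E : Set X⦄, MeasurableSet E → μ E ≠ ∞ →
    ∃ h : X → ℝ, Measurable h ∧ ∀ f, ∀ᵐ x ∂μ, x ∈ E → a f x = h x * f x

theorem IsHermitianElement.isLocallyRealMultiplication (hp : p ≠ ∞) (hp2 : p ≠ 2)
    {a : Lp ℂ p μ →L[ℂ] Lp ℂ p μ} (ha : IsHermitianElement a) :
    IsLocallyRealMultiplication a := by
  intro E hE hμE
  let e := indicatorConstLp p hE hμE (1 : ℂ)
  refine ⟨fun x => (a e x).re,
    Complex.measurable_re.comp (Lp.stronglyMeasurable (a e)).measurable, fun f => ?_⟩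
  filter_upwards [(ha.isLocal hp hp2).ae_apply_eq_mul hp hE hμE f,
    ha.ae_inner_I_smul_apply_eq_zero hp hp2 e,
    indicatorConstLp_coeFn_mem (p := p) (hs := hE) (hμs := hμE) (c := (1 : ℂ))]
    with x hmul hinner he hxE
  have im_eq_zero : (a e x).im = 0 := by
    simpa [e, he, hxE] using hinner
  rw [hmul hxE, ← Complex.conj_eq_iff_re.1 (Complex.conj_eq_iff_im.2 im_eq_zero)]
  simp only [Complex.ofReal_re, e]

theorem IsLocallyRealMultiplication.mul {a b : Lp ℂ p μ →L[ℂ] Lp ℂ p μ}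
    (ha : IsLocallyRealMultiplication a) (hb : IsLocallyRealMultiplication b) :
    IsLocallyRealMultiplication (a * b) := by
  intro E hE hμE
  obtain ⟨h, measurable_h, hh⟩ := ha hE hμE
  obtain ⟨k, measurable_k, hk⟩ := hb hE hμE
  refine ⟨fun x => h x * k x, measurable_h.mul measurable_k, fun f => ?_⟩
  filter_upwards [hh (b f), hk f] with x hx₁ hx₂ hxE
  change a (b f) x = _
  rw [hx₁ hxE, hx₂ hxE, Complex.ofReal_mul, mul_assoc]

theorem ae_of_ne_zero_of_finStronglyMeasurable {F : Type*} [TopologicalSpace F] [T2Space F]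
    [Zero F] {f : X → F} (hf : FinStronglyMeasurable f μ) {P : X → Prop}
    (h : ∀ ⦃E : Set X⦄, MeasurableSet E → μ E ≠ ∞ → ∀ᵐ x ∂μ, x ∈ E → P x) :
    ∀ᵐ x ∂μ, f x ≠ 0 → P x := by
  obtain ⟨s, hs, tendsto_s⟩ := hf
  filter_upwards [ae_all_iff.2 fun n => h (s n).measurableSet_support (hs n).ne] with x hx hfx
  by_contra hPx
  have s_eq_zero : ∀ n, s n x = 0 := fun n => Function.notMem_support.1 fun hn => hPx (hx n hn)
  exact hfx (tendsto_nhds_unique (tendsto_s x) (by simp only [s_eq_zero, tendsto_const_nhds]))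

theorem ae_of_ae_mem_of_Lp (hp : p ≠ ∞) (f g : Lp ℂ p μ) {P : X → Prop}
    (zero : ∀ x, f x = 0 → g x = 0 → P x)
    (h : ∀ ⦃E : Set X⦄, MeasurableSet E → μ E ≠ ∞ → ∀ᵐ x ∂μ, x ∈ E → P x) : ∀ᵐ x ∂μ, P x := by
  have hp0 : p ≠ 0 := (zero_lt_one.trans_le Fact.out).ne'
  filter_upwards [ae_of_ne_zero_of_finStronglyMeasurable (Lp.finStronglyMeasurable f hp0 hp) h,
    ae_of_ne_zero_of_finStronglyMeasurable (Lp.finStronglyMeasurable g hp0 hp) h] with x hf hg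
  by_contra hPx
  exact hPx (zero x (by_contra fun hfx => hPx (hf hfx)) (by_contra fun hgx => hPx (hg hgx)))

theorem norm_one_add_I_mul_le (s : ℝ) : ‖1 + Complex.I * (s : ℂ)‖ ≤ 1 + s ^ 2 / 2 := by
  have h := Complex.norm_add_mul_I 1 s
  rw [Complex.ofReal_one, one_pow, mul_comm] at h
  exact h.trans_le (Real.sqrt_one_add_le (by linarith [sq_nonneg s]))

theorem IsLocallyRealMultiplication.ae_norm_add_smul_le (hp : p ≠ ∞)
    {a : Lp ℂ p μ →L[ℂ] Lp ℂ p μ} (ha : IsLocallyRealMultiplication a) (t : ℝ) (f : Lp ℂ p μ) :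
    ∀ᵐ x ∂μ, ‖f x + Complex.I * t * a f x‖ ≤ ‖f x + (t ^ 2 / 2 : ℝ) * a (a f) x‖ := by
  refine ae_of_ae_mem_of_Lp hp f (a f) (fun x hfx hafx => ?_) fun E hE hμE => ?_
  · rw [hfx, hafx, mul_zero, add_zero, norm_zero]
    exact norm_nonneg _
  obtain ⟨h, -, hh⟩ := ha hE hμE
  filter_upwards [hh f, hh (a f)] with x h₁ h₂ hxE
  calc ‖f x + Complex.I * t * a f x‖ = ‖1 + Complex.I * ((t * h x : ℝ) : ℂ)‖ * ‖f x‖ := by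
        rw [h₁ hxE, ← norm_mul]
        push_cast
        ring_nf
    _ ≤ (1 + (t * h x) ^ 2 / 2) * ‖f x‖ :=
        mul_le_mul_of_nonneg_right (norm_one_add_I_mul_le _) (norm_nonneg _)
    _ = ‖((1 + (t * h x) ^ 2 / 2 : ℝ) : ℂ) * f x‖ := by
        rw [norm_mul, Complex.norm_of_nonneg (by positivity)]
    _ = ‖f x + (t ^ 2 / 2 : ℝ) * a (a f) x‖ := by
        rw [h₂ hxE, h₁ hxE]
        push_cast
        ring_nf

theorem IsLocallyRealMultiplication.norm_one_add_smul_le (hp : p ≠ ∞)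
    {a : Lp ℂ p μ →L[ℂ] Lp ℂ p μ} (ha : IsLocallyRealMultiplication a) (t : ℝ) :
    ‖1 + (Complex.I * (t : ℂ)) • a‖ ≤ 1 + ‖a‖ ^ 2 / 2 * t ^ 2 := by
  refine ContinuousLinearMap.opNorm_le_bound _ (by positivity) fun f => ?_
  have norm_le : ‖f + (Complex.I * (t : ℂ)) • a f‖ ≤ ‖f + ((t ^ 2 / 2 : ℝ) : ℂ) • a (a f)‖ := by
    refine Lp.norm_le_norm_of_ae_le ?_
    filter_upwards [ha.ae_norm_add_smul_le hp t f, Lp.coeFn_add f ((Complex.I * (t : ℂ)) • a f),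
      Lp.coeFn_smul (Complex.I * (t : ℂ)) (a f),
      Lp.coeFn_add f (((t ^ 2 / 2 : ℝ) : ℂ) • a (a f)),
      Lp.coeFn_smul ((t ^ 2 / 2 : ℝ) : ℂ) (a (a f))] with x hx h₁ h₂ h₃ h₄
    rwa [h₁, h₃, Pi.add_apply, Pi.add_apply, h₂, h₄, Pi.smul_apply, Pi.smul_apply, smul_eq_mul,
      smul_eq_mul]
  calc ‖(1 + (Complex.I * (t : ℂ)) • a) f‖ = ‖f + (Complex.I * (t : ℂ)) • a f‖ := rfl
    _ ≤ ‖f + ((t ^ 2 / 2 : ℝ) : ℂ) • a (a f)‖ := norm_le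
    _ ≤ ‖f‖ + t ^ 2 / 2 * ‖a (a f)‖ := (norm_add_le _ _).trans_eq <| by
        rw [norm_smul, Complex.norm_of_nonneg (by positivity)]
    _ ≤ ‖f‖ + t ^ 2 / 2 * (‖a‖ * (‖a‖ * ‖f‖)) := by
        gcongr
        exact a.le_opNorm_of_le (a.le_opNorm f)
    _ = (1 + ‖a‖ ^ 2 / 2 * t ^ 2) * ‖f‖ := by ring

theorem IsLocallyRealMultiplication.isHermitianElement [Nontrivial (Lp ℂ p μ)] (hp : p ≠ ∞)
    {a : Lp ℂ p μ →L[ℂ] Lp ℂ p μ} (ha : IsLocallyRealMultiplication a) : IsHermitianElement a :=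
  isHermitianElement_of_norm_one_add_le
    ((Asymptotics.isLittleO_pow_id one_lt_two).const_mul_left (‖a‖ ^ 2 / 2))
    (ha.norm_one_add_smul_le hp)

theorem IsHermitianElement.mul_of_Lp (hp : p ≠ ∞) (hp2 : p ≠ 2) {a b : Lp ℂ p μ →L[ℂ] Lp ℂ p μ}
    (ha : IsHermitianElement a) (hb : IsHermitianElement b) : IsHermitianElement (a * b) := by
  have := ha.nontrivial
  exact ((ha.isLocallyRealMultiplication hp hp2).mul
    (hb.isLocallyRealMultiplication hp hp2)).isHermitianElement hp

end HermitianOperators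

section LocalizableMeasures

variable {X : Type*} [MeasurableSpace X] {μ : Measure X}

theorem IsLocalizableMeasure.exists_subset_measure_pos_lt_top (hμ : IsLocalizableMeasure μ)
    {E : Set X} (hE : MeasurableSet E) (hμE : μ E ≠ 0) :
    ∃ F ⊆ E, MeasurableSet F ∧ 0 < μ F ∧ μ F < ∞ := by
  by_cases h : μ E = ∞
  · exact hμ.semifinite E hE h
  · exact ⟨E, subset_rfl, hE, pos_iff_ne_zero.2 hμE, lt_top_iff_ne_top.2 h⟩

theorem IsLocalizableMeasure.ae_of_ae_mem (hμ : IsLocalizableMeasure μ) {P : X → Prop}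
    (hP : MeasurableSet {x | P x})
    (h : ∀ ⦃E : Set X⦄, MeasurableSet E → μ E ≠ ∞ → ∀ᵐ x ∂μ, x ∈ E → P x) : ∀ᵐ x ∂μ, P x := by
  by_contra hne
  obtain ⟨F, hFP, hF, F_pos, F_lt_top⟩ := hμ.exists_subset_measure_pos_lt_top hP.compl hne
  refine F_pos.ne' (measure_eq_zero_iff_ae_notMem.2 ?_)
  filter_upwards [h hF F_lt_top.ne] with x hx hxF
  exact hFP hxF (hx hxF)

theorem IsLocalizableMeasure.exists_measurableSet_ae_mem_iff (hμ : IsLocalizableMeasure μ)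
    {ι : Type*} {E S : ι → Set X} (hE : ∀ i, MeasurableSet (E i)) (hS : ∀ i, MeasurableSet (S i))
    (compat : ∀ i j, ∀ᵐ x ∂μ, x ∈ E i → x ∈ E j → (x ∈ S i ↔ x ∈ S j)) :
    ∃ H, MeasurableSet H ∧ ∀ i, ∀ᵐ x ∂μ, x ∈ E i → (x ∈ H ↔ x ∈ S i) := by
  obtain ⟨H, hH, le_H, H_le⟩ := hμ.exists_essSup (Set.range fun i => E i ∩ S i) <| by
    rintro _ ⟨i, rfl⟩
    exact (hE i).inter (hS i)
  have mem_H : ∀ i, ∀ᵐ x ∂μ, x ∉ (E i ∩ S i) \ H := fun i =>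
    measure_eq_zero_iff_ae_notMem.1 (le_H _ ⟨i, rfl⟩)
  refine ⟨H, hH, fun i => ?_⟩
  have null_H_diff : μ (H \ (H \ (E i \ S i))) = 0 := by
    refine H_le _ (hH.diff ((hE i).diff (hS i))) ?_
    rintro _ ⟨j, rfl⟩
    refine measure_eq_zero_iff_ae_notMem.2 ?_
    filter_upwards [mem_H j, compat i j] with x hxH hij ⟨hxj, hx⟩
    exact hx ⟨by_contra fun h => hxH ⟨hxj, h⟩, fun hxi => hxi.2 ((hij hxi.1 hxj.1).2 hxj.2)⟩
  filter_upwards [mem_H i, measure_eq_zero_iff_ae_notMem.1 null_H_diff] with x hxH hx hxE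
  exact ⟨fun h => by_contra fun hxS => hx ⟨h, fun h' => h'.2 ⟨hxE, hxS⟩⟩,
    fun hxS => by_contra fun h => hxH ⟨⟨hxE, hxS⟩, h⟩⟩

-- A standard Borel space embeds measurably into `ℕ → Bool`, so it suffices to glue the countably
-- many sets where a given binary digit of the functions is `true`.
theorem IsLocalizableMeasure.exists_measurable_ae_eq (hμ : IsLocalizableMeasure μ)
    {α : Type*} [MeasurableSpace α] [StandardBorelSpace α] [Nonempty α] {ι : Type*}
    {E : ι → Set X} {f : ι → X → α} (hE : ∀ i, MeasurableSet (E i)) (hf : ∀ i, Measurable (f i))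
    (compat : ∀ i j, ∀ᵐ x ∂μ, x ∈ E i → x ∈ E j → f i x = f j x) :
    ∃ g : X → α, Measurable g ∧ ∀ i, ∀ᵐ x ∂μ, x ∈ E i → g x = f i x := by
  classical
  let digits : α → ℕ → Bool := MeasurableSpace.mapNatBool α
  have measurable_digits : Measurable digits := MeasurableSpace.measurable_mapNatBool α
  have embedding_digits : MeasurableEmbedding digits :=
    measurable_digits.measurableEmbedding (MeasurableSpace.injective_mapNatBool α)
  have exists_digit : ∀ n, ∃ H, MeasurableSet H ∧
      ∀ i, ∀ᵐ x ∂μ, x ∈ E i → (x ∈ H ↔ digits (f i x) n = true) := fun n =>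
    hμ.exists_measurableSet_ae_mem_iff (S := fun i => {x | digits (f i x) n = true}) hE
      (fun i => ((measurable_pi_apply n).comp (measurable_digits.comp (hf i)))
        (measurableSet_singleton true))
      fun i j => (compat i j).mono fun x hx hi hj => by
        rw [Set.mem_ofPred_eq, Set.mem_ofPred_eq, hx hi hj]
  choose H hH hHf using exists_digit
  refine ⟨fun x => embedding_digits.invFun fun n => decide (x ∈ H n),
    embedding_digits.measurable_invFun.comp (measurable_pi_lambda _ fun n => measurable_to_bool ?_),
    fun i => ?_⟩
  · simpa only [Set.preimage, Set.mem_singleton_iff, decide_eq_true_eq, Set.ofPred_mem_eq]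
      using hH n
  filter_upwards [ae_all_iff.2 fun n => hHf n i] with x hx hxE
  have digits_eq : (fun n => decide (x ∈ H n)) = digits (f i x) :=
    funext fun n => Bool.eq_iff_iff.2 (decide_eq_true_iff.trans (hx n hxE))
  rw [digits_eq]
  exact embedding_digits.leftInverse_invFun (f i x)

theorem IsLocalizableMeasure.nontrivial_Lp (hμ : IsLocalizableMeasure μ) (h0 : μ ≠ 0)
    {p : ℝ≥0∞} : Nontrivial (Lp ℂ p μ) := by
  obtain ⟨F, -, hF, F_pos, F_lt_top⟩ := hμ.exists_subset_measure_pos_lt_top MeasurableSet.univ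
    (Measure.measure_univ_ne_zero.2 h0)
  refine ⟨indicatorConstLp p hF F_lt_top.ne (1 : ℂ), 0, fun h => F_pos.ne' ?_⟩
  rw [← indicatorConstLp_empty (p := p) (c := (1 : ℂ))] at h
  exact ae_eq_empty.1 ((indicatorConstLp_inj hF F_lt_top.ne _ _ one_ne_zero).1 h)

variable {p : ℝ≥0∞} [Fact (1 ≤ p)] {a : Lp ℂ p μ →L[ℂ] Lp ℂ p μ}

theorem IsLocallyRealMultiplication.exists_measurable_ae_apply_eq_mul (hp : p ≠ ∞)
    (ha : IsLocallyRealMultiplication a) (hμ : IsLocalizableMeasure μ) :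
    ∃ h : X → ℝ, Measurable h ∧ ∀ f, ∀ᵐ x ∂μ, a f x = h x * f x := by
  choose k measurable_k hk using ha
  obtain ⟨h, measurable_h, hh⟩ := hμ.exists_measurable_ae_eq
    (ι := {E : Set X // MeasurableSet E ∧ μ E ≠ ∞}) (E := Subtype.val)
    (f := fun E => k E.2.1 E.2.2) (fun E => E.2.1) (fun E => measurable_k E.2.1 E.2.2)
    fun E G => by
      let e := indicatorConstLp p E.2.1 E.2.2 (1 : ℂ)
      filter_upwards [hk E.2.1 E.2.2 e, hk G.2.1 G.2.2 e,
        indicatorConstLp_coeFn_mem (p := p) (hs := E.2.1) (hμs := E.2.2) (c := (1 : ℂ))]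
        with x hxE hxG hxe hE hG
      have e_eq_one : e x = 1 := hxe hE
      simpa [e_eq_one] using (hxE hE).symm.trans (hxG hG)
  refine ⟨h, measurable_h, fun f => ?_⟩
  refine ae_of_ae_mem_of_Lp hp f (a f) (fun x hfx hafx => by rw [hafx, hfx, mul_zero])
    fun E hE hμE => ?_
  filter_upwards [hk hE hμE f, hh ⟨E, hE, hμE⟩] with x hxk hxh hxE
  rw [hxk hxE, hxh hxE]

theorem IsLocalizableMeasure.ae_norm_le_opNorm (hμ : IsLocalizableMeasure μ) (hp : p ≠ ∞)
    {h : X → ℂ} (hh : Measurable h) (ha : ∀ f, ∀ᵐ x ∂μ, a f x = h x * f x) :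
    ∀ᵐ x ∂μ, ‖h x‖ ≤ ‖a‖ := by
  have isLocal : IsLocal a := isLocal_of_ae_eq_zero_or_eq_zero fun f g hfg => by
    filter_upwards [hfg, ha f] with x hx hax
    exact hx.imp_left fun hfx => by rw [hax, hfx, mul_zero]
  refine hμ.ae_of_ae_mem (measurableSet_le hh.norm measurable_const) fun E hE hμE => ?_
  let e := indicatorConstLp p hE hμE (1 : ℂ)
  filter_upwards [isLocal.ae_norm_apply_le hp e, ha e,
    indicatorConstLp_coeFn_mem (p := p) (hs := hE) (hμs := hμE) (c := (1 : ℂ))]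
    with x hx hax hex hxE
  have e_eq_one : e x = 1 := hex hxE
  rwa [hax, e_eq_one, mul_one, norm_one, mul_one] at hx

theorem IsLocallyRealMultiplication.exists_isMultiplicationBy (hp : p ≠ ∞)
    (ha : IsLocallyRealMultiplication a) (hμ : IsLocalizableMeasure μ) :
    ∃ h : Lp ℝ ∞ μ, IsMultiplicationBy a h := by
  obtain ⟨h, measurable_h, hh⟩ := ha.exists_measurable_ae_apply_eq_mul hp hμ
  have memLp_h : MemLp h ∞ μ := by
    refine memLp_top_of_bound measurable_h.aestronglyMeasurable ‖a‖ ?_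
    filter_upwards [hμ.ae_norm_le_opNorm hp (Complex.measurable_ofReal.comp measurable_h) hh]
      with x hx
    rwa [Function.comp_apply, Complex.norm_real] at hx
  refine ⟨memLp_h.toLp h, fun f => ?_⟩
  filter_upwards [hh f, memLp_h.coeFn_toLp] with x hx hhx
  rw [hx, hhx]

theorem IsMultiplicationBy.isLocallyRealMultiplication {h : Lp ℝ ∞ μ}
    (ha : IsMultiplicationBy a h) : IsLocallyRealMultiplication a := fun _ _ _ =>
  ⟨h, (Lp.stronglyMeasurable h).measurable, fun f => (ha f).mono fun _ hx _ => hx⟩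

theorem IsLocalizableMeasure.isHermitianElement_iff (hμ : IsLocalizableMeasure μ) (hp : p ≠ ∞)
    (hp2 : p ≠ 2) (h0 : μ ≠ 0) (a : Lp ℂ p μ →L[ℂ] Lp ℂ p μ) :
    IsHermitianElement a ↔ ∃ h : Lp ℝ ∞ μ, IsMultiplicationBy a h := by
  have := hμ.nontrivial_Lp h0 (p := p)
  exact ⟨fun ha => (ha.isLocallyRealMultiplication hp hp2).exists_isMultiplicationBy hp hμ,
    fun ⟨h, hh⟩ => hh.isLocallyRealMultiplication.isHermitianElement hp⟩

end LocalizableMeasures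

namespace MeasureAlgebra

open StoneSpace

variable {𝔄 : Type*} [BooleanAlgebra 𝔄] {M : MeasureAlgebra 𝔄}

theorem stoneMeasure_diff_eq_zero_iff {E G : Set (StoneSpace 𝔄)} {a b : 𝔄}
    (hE : E =ᵐ[M.stoneMeasure] clopen a) (hG : G =ᵐ[M.stoneMeasure] clopen b) :
    M.stoneMeasure (E \ G) = 0 ↔ a ≤ b := by
  rw [measure_congr (hE.diff hG), Set.sdiff_eq, ← clopen_compl, ← clopen_inf, stoneMeasure_clopen,
    M.measure_eq_zero_iff, ← disjoint_iff, disjoint_compl_right_iff]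

theorem IsLocalizable.exists_subset_stoneMeasure_pos_lt_top (hM : M.IsLocalizable)
    {E : Set (StoneSpace 𝔄)} (hE : MeasurableSet E) (hE' : M.stoneMeasure E = ∞) :
    ∃ F ⊆ E, MeasurableSet F ∧ 0 < M.stoneMeasure F ∧ M.stoneMeasure F < ∞ := by
  obtain ⟨a, ha, -⟩ := M.existsUnique_ae_eq_clopen hE
  rw [measure_congr ha, stoneMeasure_clopen] at hE'
  obtain ⟨b, b_le_a, b_ne_bot, b_lt_top⟩ := hM.semifinite a hE'
  have measure_inter : M.stoneMeasure (E ∩ clopen b) = M.measure b := by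
    rw [measure_congr (ha.inter (EventuallyEq.refl _ (clopen b))), ← clopen_inf,
      stoneMeasure_clopen, inf_eq_right.2 b_le_a]
  refine ⟨E ∩ clopen b, Set.inter_subset_left, hE.inter (measurableSet_clopen b), ?_, ?_⟩
  · rwa [measure_inter, pos_iff_ne_zero, Ne, M.measure_eq_zero_iff]
  · rwa [measure_inter]

theorem IsLocalizable.exists_essSup_stoneMeasure (hM : M.IsLocalizable)
    {S : Set (Set (StoneSpace 𝔄))} (hS : ∀ E ∈ S, MeasurableSet E) :
    ∃ H, MeasurableSet H ∧ (∀ E ∈ S, M.stoneMeasure (E \ H) = 0) ∧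
      ∀ G, MeasurableSet G → (∀ E ∈ S, M.stoneMeasure (E \ G) = 0) →
        M.stoneMeasure (H \ G) = 0 := by
  obtain ⟨s, hs⟩ := hM.complete {a | ∃ E ∈ S, E =ᵐ[M.stoneMeasure] clopen a}
  refine ⟨clopen s, measurableSet_clopen s, fun E hE => ?_, fun G hG hSG => ?_⟩
  · obtain ⟨a, ha, -⟩ := M.existsUnique_ae_eq_clopen (hS E hE)
    exact (stoneMeasure_diff_eq_zero_iff ha EventuallyEq.rfl).2 (hs.1 ⟨E, hE, ha⟩)
  · obtain ⟨b, hb, -⟩ := M.existsUnique_ae_eq_clopen hG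
    refine (stoneMeasure_diff_eq_zero_iff EventuallyEq.rfl hb).2 (hs.2 ?_)
    rintro a ⟨E, hE, ha⟩
    exact (stoneMeasure_diff_eq_zero_iff ha hb).1 (hSG E hE)

theorem IsLocalizable.isLocalizableMeasure (hM : M.IsLocalizable) :
    IsLocalizableMeasure M.stoneMeasure where
  semifinite _ := hM.exists_subset_stoneMeasure_pos_lt_top
  exists_essSup _ := hM.exists_essSup_stoneMeasure

theorem stoneMeasure_ne_zero [Nontrivial 𝔄] (M : MeasureAlgebra 𝔄) : M.stoneMeasure ≠ 0 := by
  intro h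
  have measure_top := M.stoneMeasure_clopen ⊤
  rw [h, Measure.coe_zero, Pi.zero_apply] at measure_top
  exact top_ne_bot ((M.measure_eq_zero_iff ⊤).1 measure_top.symm)

end MeasureAlgebra

theorem mainTheorem9 (p : ℝ≥0∞) [Fact (1 ≤ p)] (hp : p ≠ ∞) (hp2 : p ≠ 2) :
    -- hermitian operators on the `L^p`-space of a nonzero localizable measure algebra
    (∀ (𝔄 : Type u) [BooleanAlgebra 𝔄] [Nontrivial 𝔄] (M : MeasureAlgebra 𝔄), M.IsLocalizable →
      ∀ a : M.Lp p →L[ℂ] M.Lp p,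
        IsHermitianElement a ↔ ∃ h : M.LinftyReal, IsMultiplicationBy a h) ∧
    -- the same on the `L^p`-space of a nonzero localizable measure
    (∀ (X : Type v) [MeasurableSpace X] (μ : Measure X), μ ≠ 0 → IsLocalizableMeasure μ →
      ∀ a : Lp ℂ p μ →L[ℂ] Lp ℂ p μ,
        IsHermitianElement a ↔ ∃ h : Lp ℝ ∞ μ, IsMultiplicationBy a h) ∧
    -- on the `L^p`-space of any measure, hermitian operators are closed under multiplication
    (∀ (X : Type v) [MeasurableSpace X] (μ : Measure X) (a b : Lp ℂ p μ →L[ℂ] Lp ℂ p μ),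
      IsHermitianElement a → IsHermitianElement b → IsHermitianElement (a * b)) :=
  ⟨fun _ _ _ M hM a => hM.isLocalizableMeasure.isHermitianElement_iff hp hp2
      M.stoneMeasure_ne_zero a,
    fun _ _ _ h0 hμ a => hμ.isHermitianElement_iff hp hp2 h0 a,
    fun _ _ _ _ _ ha hb => ha.mul_of_Lp hp hp2 hb⟩
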